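/- For a functor $F\colon \mathbf A\to\mathbf C$, suppose the right Kan extension $R=\mathrm{Ran}_F F$ exists, with counit $\varphi\colon RF\to F$. The codensity monad of $F$ is the monad $(R,\eta,\mu)$ whose unit $\eta\colon \mathrm{Id}\to R$ and multiplication $\mu\colon RR\to R$ correspond, under the universal property of $R$, to the natural transformations $\mathrm{id}\colon F\to F$ and $\varphi\circ R\varphi\colon RRF\to RF\to F$. We say that a monad $T$ on $\mathbf C$ is the codensity monad of $F$ if $\mathrm{Ran}_F F$ exists and is pointwise (i.e. for every $X\in\mathbf C$ the limit $\lim_{f\colon X\to FA}FA$ exists) and $T$ is isomorphic, as a monad, to the codensity monad of $F$. Let $\mathbf{Set}$ be the category of sets, $\mathbf{MSL}$ the category of meet-semilattices with a top element and maps preserving finite meets and the top, and, for a field $K$, $\mathbf{Vect}$ the category of $K$-vector spaces and linear maps. Let $2=\{0,1\}$, viewed as a set or as a meet-semilattice with meet given by minimum. The set of maps $\mathbf{Set}(X,2)$, the semilattice $\mathbf{MSL}(M,2)$ of morphisms with pointwise structure, and the dual space $X^*=\mathbf{Vect}(X,K)$ define contravariant functors $D$ on $\mathbf{Set}$, $\mathbf{MSL}$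 and $\mathbf{Vect}$, respectively, acting by precomposition; each gives a dual adjunction $D\dashv D$ whose unit is evaluation $X\to DDX$, and hence a monad with underlying functor $DD$. These are called the neighbourhood monad on $\mathbf{Set}$, the double dualization monad on $\mathbf{MSL}$, and the double dualization monad on $\mathbf{Vect}$. **Theorem.** 1. The neighbourhood monad $X\mapsto \mathbf{Set}(\mathbf{Set}(X,2),2)$ on $\mathbf{Set}$ is the codensity monad of the forgetful functor $\mathbf{BA}_{\mathsf f}\to\mathbf{Set}$ from the category of finite Boolean algebras. 2. The double dualization monad $M\mapsto\mathbf{MSL}(\mathbf{MSL}(M,2),2)$ on $\mathbf{MSL}$ is the codensity monad of the inclusion $\mathbf{MSL}_{\mathsf f}\hookrightarrow\mathbf{MSL}$ of the full subcategory of finite semilattices. 3. For every field $K$, the double dualization monad $X\mapsto X^{**}$ on $\mathbf{Vect}$ is the codensity monad of the inclusion $\mathbf{Vect}_{\mathsf{fd}}\hookrightarrow\mathbf{Vect}$ of the full subcategory of finite-dimensional spaces. -/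

import Mathlib

open CategoryTheory Opposite

universe w v₁ u₁ v₂ u₂

namespace CodensityPresentation

/-! ### Codensity monads -/

section Codensity

variable {A : Type u₁} [Category.{v₁} A] {C : Type u₂} [Category.{v₂} C]

/-- The multiplication `R R ⟶ R` of the codensity monad, for a right Kan extension `(R, φ)` of `F`
along itself: the transformation that corresponds, under the universal property of `(R, φ)`, to the
composite `R (R F) ⟶ R F ⟶ F` of `R φ` and `φ`. -/
noncomputable def codensityMul (F : A ⥤ C) (R : C ⥤ C) (φ : F ⋙ R ⟶ F)
    [R.IsRightKanExtension φ] : R ⋙ R ⟶ R :=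
  R.liftOfIsRightKanExtension φ (R ⋙ R)
    ((Functor.associator F R R).inv ≫ Functor.whiskerRight φ R ≫ φ)

/-- The unit `Id ⟶ R` of the codensity monad: the transformation that corresponds to the
identity `F ⟶ F`. -/
noncomputable def codensityUnit (F : A ⥤ C) (R : C ⥤ C) (φ : F ⋙ R ⟶ F)
    [R.IsRightKanExtension φ] : 𝟭 C ⟶ R :=
  R.liftOfIsRightKanExtension φ (𝟭 C) F.rightUnitor.hom

variable (F : A ⥤ C) (R : C ⥤ C) (φ : F ⋙ R ⟶ F) [R.IsRightKanExtension φ]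

lemma codensityMul_fac (X : A) :
    (codensityMul F R φ).app (F.obj X) ≫ φ.app X = R.map (φ.app X) ≫ φ.app X := by
  have h := R.liftOfIsRightKanExtension_fac_app φ (R ⋙ R)
    ((Functor.associator F R R).inv ≫ Functor.whiskerRight φ R ≫ φ) X
  simpa only [codensityMul, NatTrans.comp_app, Functor.associator_inv_app,
    Functor.whiskerRight_app, Category.id_comp] using h

lemma codensityUnit_fac (X : A) :
    (codensityUnit F R φ).app (F.obj X) ≫ φ.app X = 𝟙 _ := by
  have h := R.liftOfIsRightKanExtension_fac_app φ (𝟭 C) F.rightUnitor.hom X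
  exact h

/-- The monad structure on a right Kan extension `(R, φ)` of `F` along itself. -/
noncomputable def codensityMonadOf : Monad C where
  toFunctor := R
  η := codensityUnit F R φ
  μ := codensityMul F R φ
  assoc X := by
    have key : Functor.whiskerRight (codensityMul F R φ) R ≫ codensityMul F R φ =
        (Functor.associator R R R).hom ≫ Functor.whiskerLeft R (codensityMul F R φ) ≫
          codensityMul F R φ := by
      apply R.hom_ext_of_isRightKanExtension φ
      ext Y
      have h1 := codensityMul_fac F R φ Y
      have h2 := (codensityMul F R φ).naturality (φ.app Y)
      simp only [Functor.comp_map, Functor.comp_obj] at h2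
      simp only [Functor.comp_obj, NatTrans.comp_app, Functor.whiskerLeft_app,
        Functor.whiskerRight_app, Functor.associator_hom_app, Category.id_comp, Category.assoc, h1]
      rw [← R.map_comp_assoc, h1, R.map_comp_assoc, ← reassoc_of% h2, h1]
    simpa using NatTrans.congr_app key X
  left_unit X := by
    have key : Functor.whiskerLeft R (codensityUnit F R φ) ≫ codensityMul F R φ =
        (Functor.rightUnitor R).hom := by
      apply R.hom_ext_of_isRightKanExtension φ
      ext Y
      have h1 := codensityMul_fac F R φ Y
      have h2 := (codensityUnit F R φ).naturality (φ.app Y)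
      simp only [Functor.id_map, Functor.id_obj] at h2
      simp only [Functor.comp_obj, NatTrans.comp_app, Functor.whiskerLeft_app,
        Functor.rightUnitor_hom_app, Category.assoc, h1]
      rw [← reassoc_of% h2, codensityUnit_fac]
      exact (Category.comp_id _).trans (Category.id_comp _).symm
    simpa using NatTrans.congr_app key X
  right_unit X := by
    have key : Functor.whiskerRight (codensityUnit F R φ) R ≫ codensityMul F R φ =
        (Functor.leftUnitor R).hom := by
      apply R.hom_ext_of_isRightKanExtension φ
      ext Y
      have h1 := codensityMul_fac F R φ Y
      simp only [Functor.comp_obj, NatTrans.comp_app, Functor.whiskerLeft_app,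
        Functor.whiskerRight_app, Functor.leftUnitor_hom_app, Category.assoc, h1]
      rw [← R.map_comp_assoc, codensityUnit_fac, R.map_id]
      rfl
    simpa using NatTrans.congr_app key X

end Codensity

section Presentation

variable {A : Type u₁} [Category.{v₁} A] {C : Type u₂} [Category.{v₂} C]

/-- The codensity monad of `F`, carried by the (chosen) right Kan extension of `F` along itself. -/
noncomputable def codensityMonad (F : A ⥤ C) [F.HasRightKanExtension F] : Monad C :=
  codensityMonadOf F (F.rightKanExtension F) (F.rightKanExtensionCounit F)

/-- The monad `T` is the codensity monad of `F`: the right Kan extension of `F` along itself exists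
and is pointwise (every `X` has a limit of the diagram of all `f : X ⟶ F A`), and `T` is isomorphic,
as a monad, to the codensity monad of `F`. -/
def IsCodensityMonad (T : Monad C) (F : A ⥤ C) : Prop :=
  ∃ _ : F.HasPointwiseRightKanExtension F, Nonempty (T ≅ codensityMonad F)

end Presentation

/-! ### Self-dual adjunctions and double dualization monads -/

/-- The dual adjunction `D ⊣ D : Cᵒᵖ ⥤ C` with evaluation `ev_X : X ⟶ D (D X)` as its unit and
its counit. -/
def dualAdjunction {C : Type u₁} [Category.{v₁} C] (D : Cᵒᵖ ⥤ C) (ev : 𝟭 C ⟶ D.rightOp ⋙ D)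
    (triangle : ∀ X : C, ev.app (D.obj (op X)) ≫ D.map (ev.app X).op = 𝟙 (D.obj (op X))) :
    D.rightOp ⊣ D where
  unit := ev
  counit :=
    { app := fun Y => (ev.app Y.unop).op
      naturality := fun _ _ f => Quiver.Hom.unop_inj (ev.naturality f.unop).symm }
  left_triangle_components X := Quiver.Hom.unop_inj (triangle X)
  right_triangle_components Y := triangle Y.unop

/-! #### Sets -/

/-- The functor `Set(-, 2) : Setᵒᵖ ⥤ Set`, acting on maps by precomposition. -/
def setDual : (Type w)ᵒᵖ ⥤ Type w where
  obj X := X.unop → Bool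
  map f := TypeCat.ofHom fun p x => p (f.unop x)

/-- Evaluation `X ⟶ Set(Set(X, 2), 2)`. -/
def setEv : 𝟭 (Type w) ⟶ setDual.rightOp ⋙ setDual where
  app X := TypeCat.ofHom fun (x : X) (p : X → Bool) => p x

/-- The dual adjunction `Set(-, 2) ⊣ Set(-, 2) : Setᵒᵖ ⥤ Set`. -/
def setAdjunction : setDual.{w}.rightOp ⊣ setDual.{w} :=
  dualAdjunction setDual setEv fun _ => rfl

/-- The neighbourhood monad `X ↦ Set(Set(X, 2), 2)` on `Set`. -/
def neighbourhoodMonad : Monad (Type w) := setAdjunction.{w}.toMonad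

/-! #### Meet-semilattices with top -/

/-- The functor `MSL(-, 2) : MSLᵒᵖ ⥤ MSL`, where `2` is `Bool` with `⊓ = &&` and `⊤ = true`, the
order on hom-sets is pointwise, and the action on morphisms is precomposition. -/
noncomputable def mslDual : SemilatInfCat.{w}ᵒᵖ ⥤ SemilatInfCat.{w} where
  obj M := SemilatInfCat.of (InfTopHom M.unop Bool)
  map {M N} f := ConcreteCategory.ofHom (C := SemilatInfCat.{w})
    { toFun := fun p => InfTopHom.comp p (ConcreteCategory.hom f.unop)
      map_inf' := fun _ _ => rfl
      map_top' := rfl }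

/-- Evaluation `M ⟶ MSL(MSL(M, 2), 2)`. -/
noncomputable def mslEv : 𝟭 SemilatInfCat.{w} ⟶ mslDual.rightOp ⋙ mslDual where
  app M := ConcreteCategory.ofHom (C := SemilatInfCat.{w})
    { toFun := fun x =>
        { toFun := fun p : InfTopHom M Bool => p x
          map_inf' := fun _ _ => rfl
          map_top' := rfl }
      map_inf' := fun x y => InfTopHom.ext fun p : InfTopHom M Bool => p.map_inf' x y
      map_top' := InfTopHom.ext fun p : InfTopHom M Bool => p.map_top' }

/-- The dual adjunction `MSL(-, 2) ⊣ MSL(-, 2) : MSLᵒᵖ ⥤ MSL`. -/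
noncomputable def mslAdjunction : mslDual.{w}.rightOp ⊣ mslDual.{w} :=
  dualAdjunction mslDual mslEv fun _ => rfl

/-- The double dualization monad `M ↦ MSL(MSL(M, 2), 2)` on `MSL`. -/
noncomputable def mslDoubleDualMonad : Monad SemilatInfCat.{w} := mslAdjunction.{w}.toMonad

/-- Finiteness of a meet-semilattice with top. -/
def finiteMSL : ObjectProperty SemilatInfCat.{w} := fun M => Finite M

/-! #### Vector spaces -/

section Vect

variable (K : Type w) [Field K]

/-- The functor `X ↦ X* = Vect(X, K) : Vectᵒᵖ ⥤ Vect`. -/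
def vectDual : (ModuleCat.{w} K)ᵒᵖ ⥤ ModuleCat.{w} K where
  obj X := ModuleCat.of K (Module.Dual K X.unop)
  map f := ModuleCat.ofHom (Module.Dual.transpose f.unop.hom)

/-- Evaluation `X ⟶ X**`. -/
def vectEv : 𝟭 (ModuleCat.{w} K) ⟶ (vectDual K).rightOp ⋙ vectDual K where
  app X := ModuleCat.ofHom (Module.Dual.eval K X)

/-- The dual adjunction `(-)* ⊣ (-)* : Vectᵒᵖ ⥤ Vect`. -/
def vectAdjunction : (vectDual K).rightOp ⊣ vectDual K :=
  dualAdjunction (vectDual K) (vectEv K) fun _ => rfl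

/-- The double dualization monad `X ↦ X**` on `Vect`. -/
def vectDoubleDualMonad : Monad (ModuleCat.{w} K) := (vectAdjunction K).toMonad

end Vect

end CodensityPresentation

/-! In all three cases a dualizing object `2` (or `K`) occurs, up to universe, among the `F a`, and
an element of `F a` amounts to a compatible assignment of values to the homomorphisms `h : F a ⟶ 2`.
For finite Boolean algebras this is finite Stone duality; for finite semilattices and
finite-dimensional spaces it is reflexivity. Hence there is a counit `φ : T F ⟶ F` determined by `h
(φ t) = t h`, and its naturality and monad compatibilities can be tested on such `h`. A cone `s`
from `S` over the maps `X ⟶ F a` must lift by `l x p = s_2(p)(x)` for `p : X ⟶ 2`, which gives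
uniqueness. Compatibility of `s` along each `h` makes this a factorization. Over `Set`, `l x` may be
any function; otherwise the leg at `2 ^ 2` or `K ^ 2` shows that `l x` respects the binary
operation. -/

namespace CodensityPresentation

/-! ### Recognizing codensity monads -/

section Criterion

variable {A : Type u₁} [Category.{v₁} A] {C : Type u₂} [Category.{v₂} C]

/-- A monad isomorphic as an endofunctor to a right Kan extension of `F` along itself, with unit and
multiplication compatible with the counit, is isomorphic to the codensity monad. -/
theorem nonempty_iso_codensityMonadOf (T : Monad C) (F : A ⥤ C) (φ : F ⋙ T.toFunctor ⟶ F)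
    [T.toFunctor.IsRightKanExtension φ]
    (unit_fac : ∀ a, T.η.app (F.obj a) ≫ φ.app a = 𝟙 (F.obj a))
    (mul_fac : ∀ a, T.μ.app (F.obj a) ≫ φ.app a = T.map (φ.app a) ≫ φ.app a)
    (R : C ⥤ C) (ψ : F ⋙ R ⟶ F) [R.IsRightKanExtension ψ] :
    Nonempty (T ≅ codensityMonadOf F R ψ) := by
  let e : T.toFunctor ≅ R := Functor.rightKanExtensionUnique T.toFunctor φ R ψ
  -- The comparison `e` is characterized by carrying `ψ` back to `φ`; the monad laws for `e` are
  -- then checked after restriction along `F` and composition with `ψ`.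
  have he (a : A) : e.hom.app (F.obj a) ≫ ψ.app a = φ.app a :=
    (R.liftOfIsRightKanExtension_fac_app ψ T.toFunctor (φ ≫ (Iso.refl F).hom) a).trans
      (Category.comp_id _)
  have hη : T.η ≫ e.hom = codensityUnit F R ψ := by
    apply R.hom_ext_of_isRightKanExtension ψ
    ext a
    have h1 := codensityUnit_fac F R ψ a
    simp only [NatTrans.comp_app, Functor.whiskerLeft_app, Category.assoc, he, unit_fac, h1]
    rfl
  have hμ : T.μ ≫ e.hom =
      Functor.whiskerRight e.hom T.toFunctor ≫ Functor.whiskerLeft R e.hom ≫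
        codensityMul F R ψ := by
    apply R.hom_ext_of_isRightKanExtension ψ
    ext a
    have h1 := codensityMul_fac F R ψ a
    have h2 := e.hom.naturality (ψ.app a)
    simp only [NatTrans.comp_app, Functor.whiskerLeft_app, Functor.whiskerRight_app,
      Category.assoc, he, mul_fac, h1]
    rw [← reassoc_of% h2, he, ← T.map_comp_assoc, he]
  refine ⟨MonadIso.mk (N := codensityMonadOf F R ψ) e (fun X => NatTrans.congr_app hη X)
    (fun X => ?_)⟩
  have := NatTrans.congr_app hμ X
  simp only [NatTrans.comp_app, Functor.whiskerLeft_app, Functor.whiskerRight_app,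
    ← Category.assoc] at this
  exact this

/-- A criterion for a monad to be the codensity monad of `F`, with the limit property of the
cones `T X ⟶ T (F a) ⟶ F a` written out. -/
theorem isCodensityMonad_of_existsUnique_lift (T : Monad C) (F : A ⥤ C)
    (φ : F ⋙ T.toFunctor ⟶ F)
    (unit_fac : ∀ a, T.η.app (F.obj a) ≫ φ.app a = 𝟙 (F.obj a))
    (mul_fac : ∀ a, T.μ.app (F.obj a) ≫ φ.app a = T.map (φ.app a) ≫ φ.app a)
    (existsUnique_lift : ∀ (X S : C) (s : ∀ a, (X ⟶ F.obj a) → (S ⟶ F.obj a)),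
      (∀ {a b} (f : X ⟶ F.obj a) (g : a ⟶ b), s b (f ≫ F.map g) = s a f ≫ F.map g) →
      ∃! l : S ⟶ T.obj X, ∀ a f, l ≫ T.map f ≫ φ.app a = s a f) :
    IsCodensityMonad T F := by
  have pointwise : (Functor.RightExtension.mk T.toFunctor φ).IsPointwiseRightKanExtension := by
    intro X
    -- A cone over the comma category is exactly a compatible family `s`.
    have key (c : Limits.Cone (StructuredArrow.proj X F ⋙ F)) :=
      existsUnique_lift X c.pt (fun a f => c.π.app (StructuredArrow.mk f)) (by
        intro a b f g
        have := c.w (StructuredArrow.homMk g :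
          StructuredArrow.mk f ⟶ StructuredArrow.mk (f ≫ F.map g))
        exact this.symm)
    choose l hl hu using key
    exact
      { lift := l
        fac := fun c j => hl c j.right j.hom
        uniq := fun c m hm => hu c m fun a f => hm (StructuredArrow.mk f) }
  have : T.toFunctor.IsRightKanExtension φ := pointwise.isRightKanExtension
  refine ⟨pointwise.hasPointwiseRightKanExtension, ?_⟩
  have := pointwise.hasPointwiseRightKanExtension
  exact nonempty_iso_codensityMonadOf T F φ unit_fac mul_fac _ _

end Criterion

/-! ### Finite Stone duality -/

section FiniteBooleanAlgebra

variable {B : Type*} [BooleanAlgebra B]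

/-- The homomorphism to `2` given by an atom. -/
noncomputable def atomHom {a : B} (ha : IsAtom a) : BoundedLatticeHom B Bool := by
  classical
  exact
  { toFun := fun x => decide (a ≤ x)
    map_sup' := fun x y => by
      have : a ≤ x ⊔ y ↔ a ≤ x ∨ a ≤ y := by
        refine ⟨fun h => ?_, fun h => h.elim le_sup_of_le_left le_sup_of_le_right⟩
        by_contra! hn
        have hx := (ha.not_le_iff_disjoint.1 hn.1)
        have hy := (ha.not_le_iff_disjoint.1 hn.2)
        exact ha.1 (disjoint_self.1 ((hx.sup_right hy).mono_right h))
      simp [this]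
    map_inf' := fun x y => by simp
    map_top' := by simp
    map_bot' := by simpa using ha.1 }

theorem atomHom_apply_eq_true {a : B} (ha : IsAtom a) (x : B) :
    atomHom ha x = true ↔ a ≤ x := by
  simp [atomHom]

/-- If `h x` were true with `a` not below `x`, then `a ⊓ x = ⊥` would be sent to true. -/
theorem eq_atomHom {a : B} (ha : IsAtom a) {h : BoundedLatticeHom B Bool} (hh : h a = true) :
    h = atomHom ha := by
  ext x
  rw [Bool.eq_iff_iff, atomHom_apply_eq_true]
  constructor
  · intro hx
    by_contra hn
    have h1 : a ⊓ x = ⊥ := (ha.not_le_iff_disjoint.1 hn).eq_bot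
    have h2 := congrArg h h1
    simp [hh, hx] at h2
  · intro hx
    have := OrderHomClass.mono h hx
    rw [hh] at this
    exact top_le_iff.1 this

/-- The truth set of `h` is an ultrafilter, closed under its finite meet. Anything strictly below
that meet has its complement in the ultrafilter, so it lies below its own complement and is `⊥`. -/
theorem exists_isAtom_apply_eq_true [Finite B] (h : BoundedLatticeHom B Bool) :
    ∃ a, IsAtom a ∧ h a = true := by
  classical
  have := Fintype.ofFinite B
  let s : Finset B := {x | h x = true}
  have hs : h (s.inf id) = true := by
    rw [map_finset_inf]
    exact top_le_iff.1 (Finset.le_inf fun x hx => top_le_iff.2 (by simpa [s] using hx))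
  refine ⟨s.inf id, ⟨fun h0 => ?_, fun y hy => ?_⟩, hs⟩
  · rw [h0, map_bot] at hs
    exact Bool.false_ne_true hs
  · have hy' : ¬ h y = true := fun hn =>
      hy.not_ge (Finset.inf_le (f := id) (by simpa [s] using hn))
    have hyc : h yᶜ = true := by
      rw [map_compl']
      simpa using hy'
    have : s.inf id ≤ yᶜ := Finset.inf_le (f := id) (by simpa [s] using hyc)
    exact disjoint_self.1 (le_compl_iff_disjoint_right.1 (hy.le.trans this))

/-- Every family of truth values on the homomorphisms from a finite Boolean algebra to `2` is evaluation
at an element. -/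
theorem exists_forall_apply_eq [Finite B] (t : BoundedLatticeHom B Bool → Bool) :
    ∃ b, ∀ h : BoundedLatticeHom B Bool, h b = t h := by
  classical
  have := Fintype.ofFinite B
  -- The required element is the join of the atoms whose homomorphisms `t` marks true.
  let s : Finset B := {a | ∃ ha : IsAtom a, t (atomHom ha) = true}
  refine ⟨s.sup id, fun h => ?_⟩
  obtain ⟨a, ha, hh⟩ := exists_isAtom_apply_eq_true h
  obtain rfl := eq_atomHom ha hh
  rw [Bool.eq_iff_iff]
  constructor
  · intro hs
    by_contra ht
    have : atomHom ha (s.sup id) ≤ ⊥ := by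
      rw [map_finset_sup]
      refine Finset.sup_le fun b hb => ?_
      obtain ⟨hb, hbt⟩ : ∃ hb : IsAtom b, t (atomHom hb) = true := by simpa [s] using hb
      refine le_of_eq (Bool.eq_false_iff.2 fun hab => ht ?_)
      rw [eq_atomHom hb hab]
      exact hbt
    rw [hs] at this
    exact absurd this (by decide)
  · intro ht
    rw [atomHom_apply_eq_true]
    exact Finset.le_sup (f := id) (by simpa [s] using ⟨ha, ht⟩)

/-- Otherwise an atom below `x ⊓ yᶜ` gives a homomorphism separating `x` from `y`. -/
theorem le_of_forall_apply_eq [Finite B] {x y : B}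
    (hxy : ∀ h : BoundedLatticeHom B Bool, h x = h y) : x ≤ y := by
  by_contra hn
  obtain h0 | ⟨a, ha, hle⟩ := eq_bot_or_exists_atom_le (x ⊓ yᶜ)
  · exact hn (disjoint_compl_right_iff.1 (disjoint_iff.2 h0))
  · have hax : atomHom ha x = true := (atomHom_apply_eq_true ha x).2 (hle.trans inf_le_left)
    rw [hxy, atomHom_apply_eq_true] at hax
    exact ha.1 (disjoint_self.1 ((disjoint_compl_right (a := y)).mono hax (hle.trans inf_le_right)))

theorem eq_of_forall_apply_eq [Finite B] {x y : B}
    (hxy : ∀ h : BoundedLatticeHom B Bool, h x = h y) : x = y :=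
  (le_of_forall_apply_eq hxy).antisymm (le_of_forall_apply_eq fun h => (hxy h).symm)

end FiniteBooleanAlgebra

/-! ### Reflexivity of finite semilattices -/

section FiniteSemilattice

variable {M : Type*} [SemilatticeInf M] [OrderTop M]

/-- The homomorphism to `2` whose truth set is the principal filter of `a`. -/
noncomputable def principalHom (a : M) : InfTopHom M Bool := by
  classical
  exact
  { toFun := fun x => decide (a ≤ x)
    map_inf' := fun x y => by simp
    map_top' := by simp }

theorem principalHom_apply_eq_true (a x : M) : principalHom a x = true ↔ a ≤ x := by
  simp [principalHom]

theorem eq_of_forall_infTopHom_apply_eq {x y : M}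
    (hxy : ∀ p : InfTopHom M Bool, p x = p y) : x = y := by
  apply le_antisymm
  · rw [← principalHom_apply_eq_true, ← hxy, principalHom_apply_eq_true]
  · rw [← principalHom_apply_eq_true, hxy, principalHom_apply_eq_true]

/-- A finite filter contains its meet, which generates it. -/
theorem exists_eq_principalHom [Finite M] (p : InfTopHom M Bool) : ∃ a, p = principalHom a := by
  classical
  have := Fintype.ofFinite M
  let s : Finset M := {x | p x = true}
  have hs : p (s.inf id) = true := by
    rw [map_finset_inf]
    exact top_le_iff.1 (Finset.le_inf fun x hx => top_le_iff.2 (by simpa [s] using hx))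
  refine ⟨s.inf id, InfTopHom.ext fun x => ?_⟩
  rw [Bool.eq_iff_iff, principalHom_apply_eq_true]
  constructor
  · intro hx
    exact Finset.inf_le (f := id) (by simpa [s] using hx)
  · intro hx
    have := OrderHomClass.mono p hx
    rw [hs] at this
    exact top_le_iff.1 this

/-- Finite meet-semilattices are reflexive. -/
theorem exists_forall_infTopHom_apply_eq [Finite M] (t : InfTopHom (InfTopHom M Bool) Bool) :
    ∃ x, ∀ p : InfTopHom M Bool, p x = t p := by
  have : Finite (InfTopHom M Bool) := DFunLike.finite _
  -- Principality is used twice: `t` is the filter above some `p₀`, and `p₀` the filter above some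
  -- `x`. Then `t p` holds iff `p₀ ≤ p`, that is, iff `p x` holds.
  obtain ⟨p₀, rfl⟩ := exists_eq_principalHom t
  obtain ⟨x, rfl⟩ := exists_eq_principalHom p₀
  refine ⟨x, fun p => ?_⟩
  rw [Bool.eq_iff_iff, principalHom_apply_eq_true]
  constructor
  · intro hp y
    rw [Bool.le_iff_imp]
    intro hy
    rw [principalHom_apply_eq_true] at hy
    have := OrderHomClass.mono p hy
    rw [hp] at this
    exact top_le_iff.1 this
  · intro hp
    have := hp x
    rw [Bool.le_iff_imp] at this
    exact this ((principalHom_apply_eq_true x x).2 le_rfl)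

end FiniteSemilattice

/-! ### The neighbourhood monad -/

section Sets

/-- The element of a finite Boolean algebra with prescribed values under homomorphisms to `2`. -/
noncomputable def boolAlgEval {B : Type*} [BooleanAlgebra B] [Finite B] (t : (B → Bool) → Bool) :
    B :=
  (exists_forall_apply_eq fun h : BoundedLatticeHom B Bool => t h).choose

theorem apply_boolAlgEval {B : Type*} [BooleanAlgebra B] [Finite B] (t : (B → Bool) → Bool)
    (h : BoundedLatticeHom B Bool) : h (boolAlgEval t) = t h :=
  (exists_forall_apply_eq fun h : BoundedLatticeHom B Bool => t h).choose_spec h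

/-- The counit `Set(Set(B, 2), 2) ⟶ B` at finite Boolean algebras `B`. -/
noncomputable def boolAlgCounit :
    forget FinBoolAlg.{w} ⋙ neighbourhoodMonad.{w}.toFunctor ⟶ forget FinBoolAlg.{w} where
  app B := TypeCat.ofHom fun t : (B → Bool) → Bool => boolAlgEval t
  naturality B B' g := by
    ext (t : (B → Bool) → Bool)
    refine eq_of_forall_apply_eq (B := B') fun h => ?_
    refine (apply_boolAlgEval _ h).trans ?_
    exact (apply_boolAlgEval t (h.comp (ConcreteCategory.hom g))).symm

/-- The two-element Boolean algebra, in any universe. -/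
abbrev boolAlgTwo : FinBoolAlg.{w} := FinBoolAlg.of (PUnit.{w + 1} → Bool)

/-- Homomorphisms to `2` as morphisms of finite Boolean algebras. -/
noncomputable def toBoolAlgTwo {B : FinBoolAlg.{w}} (h : BoundedLatticeHom B Bool) : B ⟶ boolAlgTwo.{w} :=
  ConcreteCategory.ofHom (C := FinBoolAlg.{w})
    { toFun := fun x _ => h x
      map_sup' := fun x y => funext fun _ => map_sup h x y
      map_inf' := fun x y => funext fun _ => map_inf h x y
      map_top' := funext fun _ => map_top h
      map_bot' := funext fun _ => map_bot h }

/-- Evaluation of `2` at its index, as a homomorphism. -/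
noncomputable def ofBoolAlgTwo : BoundedLatticeHom (PUnit.{w + 1} → Bool) Bool where
  toFun x := x PUnit.unit
  map_sup' _ _ := rfl
  map_inf' _ _ := rfl
  map_top' := rfl
  map_bot' := rfl

theorem isCodensityMonad_neighbourhoodMonad :
    IsCodensityMonad neighbourhoodMonad.{w} (forget FinBoolAlg.{w}) := by
  refine isCodensityMonad_of_existsUnique_lift _ _ boolAlgCounit (fun B => ?_) (fun B => ?_)
    (fun X S s hs => ?_)
  · ext (b : B)
    exact eq_of_forall_apply_eq (B := B) fun h => apply_boolAlgEval _ h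
  · ext (t : ((((B → Bool) → Bool) → Bool) → Bool))
    refine eq_of_forall_apply_eq (B := B) fun h => ?_
    refine (apply_boolAlgEval _ h).trans ?_
    refine Eq.trans ?_ (apply_boolAlgEval _ h).symm
    -- Tested on `h`, the two sides are `t` at `u ↦ u h` and at `u ↦ h (boolAlgEval u)`.
    refine congrArg t (funext fun u => ?_)
    exact (apply_boolAlgEval u h).symm
  · let two (p : X → Bool) : X ⟶ (forget FinBoolAlg.{w}).obj boolAlgTwo.{w} :=
      TypeCat.ofHom fun x (_ : PUnit.{w + 1}) => p x
    let ev (x : S) (p : X → Bool) : Bool :=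
      ofBoolAlgTwo.{w} (ConcreteCategory.hom (s boolAlgTwo.{w} (two p)) x)
    refine ⟨TypeCat.ofHom ev, fun B f => ?_, fun m hm => ?_⟩
    · ext x
      refine eq_of_forall_apply_eq (B := B) fun h => ?_
      refine (apply_boolAlgEval _ h).trans ?_
      -- The leg at `h ∘ f` is `h` after the leg at `f`.
      have := ConcreteCategory.congr_hom (hs f (toBoolAlgTwo h)) x
      exact congrFun this PUnit.unit
    · ext x
      funext (p : X → Bool)
      have := ConcreteCategory.congr_hom (hm boolAlgTwo.{w} (two p)) x
      refine Eq.trans ?_ (congrArg ofBoolAlgTwo.{w} this)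
      exact (apply_boolAlgEval
        (fun q => (ConcreteCategory.hom m x : (X → Bool) → Bool) fun y => q fun _ => p y)
        ofBoolAlgTwo.{w}).symm

end Sets

/-! ### Double dualization of semilattices -/

section Semilattices

instance (M : finiteMSL.{w}.FullSubcategory) : Finite M.obj := M.property

/-- The element of a finite meet-semilattice with prescribed values under homomorphisms to `2`. -/
noncomputable def mslEval (M : Type*) [SemilatticeInf M] [OrderTop M] [Finite M] :
    InfTopHom (InfTopHom (InfTopHom M Bool) Bool) M where
  toFun t := (exists_forall_infTopHom_apply_eq t).choose
  map_inf' t u := eq_of_forall_infTopHom_apply_eq fun p => by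
    rw [map_inf, (exists_forall_infTopHom_apply_eq _).choose_spec,
      (exists_forall_infTopHom_apply_eq _).choose_spec,
      (exists_forall_infTopHom_apply_eq _).choose_spec]
    rfl
  map_top' := eq_of_forall_infTopHom_apply_eq fun p => by
    rw [map_top, (exists_forall_infTopHom_apply_eq _).choose_spec]
    rfl

theorem apply_mslEval {M : Type*} [SemilatticeInf M] [OrderTop M] [Finite M]
    (t : InfTopHom (InfTopHom M Bool) Bool) (p : InfTopHom M Bool) : p (mslEval M t) = t p :=
  (exists_forall_infTopHom_apply_eq t).choose_spec p

/-- The counit `MSL(MSL(M, 2), 2) ⟶ M` at finite semilattices `M`. -/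
noncomputable def mslCounit :
    finiteMSL.{w}.ι ⋙ mslDoubleDualMonad.{w}.toFunctor ⟶ finiteMSL.{w}.ι where
  app M := ConcreteCategory.ofHom (C := SemilatInfCat.{w}) (mslEval M.obj)
  naturality M N g := by
    refine InfTopHom.ext fun t : InfTopHom (InfTopHom M.obj Bool) Bool => ?_
    refine eq_of_forall_infTopHom_apply_eq (M := N.obj) fun p => ?_
    refine (apply_mslEval (M := N.obj) _ p).trans ?_
    exact (apply_mslEval t (p.comp (ConcreteCategory.hom g.hom))).symm

/-- The power `2 ^ ι` as a finite semilattice. -/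
noncomputable def mslPower (ι : Type w) [Finite ι] : finiteMSL.{w}.FullSubcategory :=
  ⟨SemilatInfCat.of (ι → Bool), inferInstanceAs (Finite (ι → Bool))⟩

/-- The morphism to `2 ^ ι` with given components. -/
noncomputable def toMslPower {M : SemilatInfCat.{w}} {ι : Type w} [Finite ι] (p : ι → InfTopHom M Bool) :
    M ⟶ finiteMSL.{w}.ι.obj (mslPower ι) :=
  ConcreteCategory.ofHom (C := SemilatInfCat.{w})
    ({ toFun := fun x i => p i x
       map_inf' := fun x y => funext fun i => map_inf (p i) x y
       map_top' := funext fun i => map_top (p i) } : InfTopHom M (ι → Bool))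

/-- The `i`-th projection of a power of `2`. -/
noncomputable def mslProj {ι : Type w} (i : ι) : InfTopHom (ι → Bool) Bool where
  toFun x := x i
  map_inf' _ _ := rfl
  map_top' := rfl

theorem isCodensityMonad_mslDoubleDualMonad :
    IsCodensityMonad mslDoubleDualMonad.{w} finiteMSL.{w}.ι := by
  refine isCodensityMonad_of_existsUnique_lift _ _ mslCounit (fun M => ?_) (fun M => ?_)
    (fun X S s hs => ?_)
  · refine InfTopHom.ext fun b : M.obj => ?_
    exact eq_of_forall_infTopHom_apply_eq (M := M.obj) fun h =>
      apply_mslEval (M := M.obj) _ h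
  · refine InfTopHom.ext fun t : InfTopHom (InfTopHom (InfTopHom (InfTopHom M.obj Bool) Bool)
      Bool) Bool => ?_
    refine eq_of_forall_infTopHom_apply_eq (M := M.obj) fun p => ?_
    refine (apply_mslEval (M := M.obj) _ p).trans ?_
    refine Eq.trans ?_ (apply_mslEval (M := M.obj) _ p).symm
    refine congrArg t (InfTopHom.ext fun u => ?_)
    exact (apply_mslEval (M := M.obj) u p).symm
  · let leg {M : finiteMSL.{w}.FullSubcategory} (f : X ⟶ M.obj) : InfTopHom S M.obj :=
      ConcreteCategory.hom (s M f)
    have leg_comp {M N : finiteMSL.{w}.FullSubcategory} (f : X ⟶ M.obj)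
        (g : M.obj ⟶ N.obj) (x : S) : leg (f ≫ g) x = ConcreteCategory.hom g (leg f x) :=
      ConcreteCategory.congr_hom (hs f (ObjectProperty.homMk g)) x
    let ev (x : S) (p : InfTopHom X Bool) : Bool :=
      mslProj PUnit.unit (leg (toMslPower fun _ : PUnit.{w + 1} => p) x)
    have ev_comp {M : finiteMSL.{w}.FullSubcategory} (f : X ⟶ M.obj) (q : InfTopHom M.obj Bool)
        (x : S) : ev x (q.comp (ConcreteCategory.hom f)) = q (leg f x) :=
      congrFun (leg_comp f (toMslPower fun _ : PUnit.{w + 1} => q) x) PUnit.unit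
    -- Pair `p` and `q` into a map to `2 ^ 2`: they are its two projections, and `p ⊓ q` is its
    -- composite with the meet of the projections, again a homomorphism.
    have ev_inf (x : S) (p q : InfTopHom X Bool) : ev x (p ⊓ q) = ev x p ⊓ ev x q := by
      let f : X ⟶ (mslPower (ULift.{w} Bool)).obj :=
        toMslPower fun i => if i.down then p else q
      have h1 := ev_comp f (mslProj ⟨true⟩) x
      have h2 := ev_comp f (mslProj ⟨false⟩) x
      have h3 := ev_comp f (mslProj ⟨true⟩ ⊓ mslProj ⟨false⟩) x
      refine Eq.trans h3 ?_
      exact (congrArg₂ (· ⊓ ·) h1 h2).symm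
    have ev_top (x : S) : ev x ⊤ = ⊤ := by
      let f : X ⟶ (mslPower PUnit.{w + 1}).obj := toMslPower fun _ => ⊤
      exact ev_comp f ⊤ x
    let l : InfTopHom S (InfTopHom (InfTopHom X Bool) Bool) :=
      { toFun := fun x => { toFun := ev x, map_inf' := ev_inf x, map_top' := ev_top x }
        map_inf' := fun x y => InfTopHom.ext fun p =>
          congrFun ((leg (toMslPower fun _ : PUnit.{w + 1} => p)).map_inf' x y) PUnit.unit
        map_top' := InfTopHom.ext fun p =>
          congrFun ((leg (toMslPower fun _ : PUnit.{w + 1} => p)).map_top') PUnit.unit }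
    refine ⟨l, fun M f => ?_, fun m hm => ?_⟩
    · refine InfTopHom.ext fun x : S => ?_
      refine eq_of_forall_infTopHom_apply_eq (M := M.obj) fun p => ?_
      refine (apply_mslEval (M := M.obj) _ p).trans ?_
      exact ev_comp f p x
    · refine InfTopHom.ext fun x : S => InfTopHom.ext fun p : InfTopHom X Bool => ?_
      -- The factorization at `p` itself, read at the identity of `2`, forces the value of `m x` at
      -- `p`.
      have := ConcreteCategory.congr_hom
        (hm (mslPower PUnit.{w + 1}) (toMslPower fun _ : PUnit.{w + 1} => p)) x
      refine Eq.trans ?_ (congrArg (mslProj PUnit.unit) this)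
      exact (apply_mslEval (M := (mslPower PUnit.{w + 1}).obj)
        ((ConcreteCategory.hom (m ≫ mslDoubleDualMonad.map (toMslPower fun _ => p)) x :
          InfTopHom (InfTopHom (mslPower PUnit.{w + 1}).obj Bool) Bool))
        (mslProj PUnit.unit)).symm

end Semilattices

/-! ### Double dualization of vector spaces -/

section VectorSpaces

variable (K : Type w) [Field K]

theorem eq_of_forall_dual_apply_eq {V : Type*} [AddCommGroup V] [Module K V] [Module.Finite K V]
    {x y : V} (hxy : ∀ p : Module.Dual K V, p x = p y) : x = y :=
  (Module.evalEquiv K V).injective (LinearMap.ext hxy)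

instance (V : (ModuleCat.isFG.{w} K).FullSubcategory) : Module.Finite K V.obj := V.property

/-- The inverse `V** ⟶ V` of evaluation at finite-dimensional spaces `V`. -/
noncomputable def vectCounit :
    (ModuleCat.isFG.{w} K).ι ⋙ (vectDoubleDualMonad K).toFunctor ⟶ (ModuleCat.isFG.{w} K).ι where
  app V := ModuleCat.ofHom (Module.evalEquiv K V.obj).symm.toLinearMap
  naturality V W g := by
    ext (t : Module.Dual K (Module.Dual K V.obj))
    refine eq_of_forall_dual_apply_eq K (V := W.obj) fun p => ?_
    refine (Module.apply_evalEquiv_symm_apply K W.obj p _).trans ?_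
    exact (Module.apply_evalEquiv_symm_apply K V.obj (p ∘ₗ g.hom.hom) t).symm

/-- A space `K ^ ι` with `ι` finite, as a finite-dimensional space. -/
def vectPower (ι : Type) [Finite ι] : (ModuleCat.isFG.{w} K).FullSubcategory :=
  ⟨ModuleCat.of K (ι → K), inferInstanceAs (Module.Finite K (ι → K))⟩

theorem isCodensityMonad_vectDoubleDualMonad :
    IsCodensityMonad (vectDoubleDualMonad K) (ModuleCat.isFG.{w} K).ι := by
  refine isCodensityMonad_of_existsUnique_lift _ _ (vectCounit K) (fun V => ?_) (fun V => ?_)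
    (fun X S s hs => ?_)
  · ext (v : V.obj)
    exact (Module.evalEquiv K V.obj).symm_apply_apply v
  · ext (t : Module.Dual K (Module.Dual K (Module.Dual K (Module.Dual K V.obj))))
    refine eq_of_forall_dual_apply_eq K (V := V.obj) fun p => ?_
    refine (Module.apply_evalEquiv_symm_apply K V.obj p _).trans ?_
    refine Eq.trans ?_ (Module.apply_evalEquiv_symm_apply K V.obj p _).symm
    refine congrArg t (LinearMap.ext fun u => ?_)
    exact (Module.apply_evalEquiv_symm_apply K V.obj p u).symm
  · let line : (ModuleCat.isFG.{w} K).FullSubcategory :=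
      ⟨ModuleCat.of K K, inferInstanceAs (Module.Finite K K)⟩
    let ev (x : S) (p : Module.Dual K X) : K := (s line (ModuleCat.ofHom p)).hom x
    have ev_comp {V : (ModuleCat.isFG.{w} K).FullSubcategory} (f : X ⟶ V.obj)
        (q : Module.Dual K V.obj) (x : S) : ev x (q ∘ₗ f.hom) = q ((s V f).hom x) :=
      ConcreteCategory.congr_hom (hs (b := line) f (ObjectProperty.homMk (ModuleCat.ofHom q))) x
    -- As for meets, with the sum of the projections `K ^ 2 ⟶ K`.
    have ev_add (x : S) (p q : Module.Dual K X) : ev x (p + q) = ev x p + ev x q := by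
      let f : X ⟶ (vectPower K (Fin 2)).obj := ModuleCat.ofHom (LinearMap.pi ![p, q])
      have h1 := ev_comp f (LinearMap.proj 0) x
      have h2 := ev_comp f (LinearMap.proj 1) x
      have h3 := ev_comp f ((LinearMap.proj 0 : (Fin 2 → K) →ₗ[K] K) + LinearMap.proj 1) x
      exact h3.trans (congrArg₂ (· + ·) h1 h2).symm
    -- Scaling by `c` is an endomorphism of the line, so compatibility applies to it directly.
    have ev_smul (x : S) (c : K) (p : Module.Dual K X) : ev x (c • p) = c • ev x p :=
      ev_comp (V := line) (ModuleCat.ofHom p) (c • LinearMap.id) x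
    let l : S →ₗ[K] Module.Dual K (Module.Dual K X) :=
      { toFun := fun x => { toFun := ev x, map_add' := ev_add x, map_smul' := ev_smul x }
        map_add' := fun x y => LinearMap.ext fun p =>
          map_add (s line (ModuleCat.ofHom p)).hom x y
        map_smul' := fun c x => LinearMap.ext fun p =>
          map_smul (s line (ModuleCat.ofHom p)).hom c x }
    refine ⟨ModuleCat.ofHom l, fun V f => ?_, fun m hm => ?_⟩
    · ext x
      refine eq_of_forall_dual_apply_eq K (V := V.obj) fun p => ?_
      refine (Module.apply_evalEquiv_symm_apply K V.obj p _).trans ?_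
      exact ev_comp f p x
    · ext x
      refine LinearMap.ext fun p : Module.Dual K X => ?_
      have := ConcreteCategory.congr_hom (hm line (ModuleCat.ofHom p)) x
      refine Eq.trans ?_ this
      exact (Module.apply_evalEquiv_symm_apply K K (LinearMap.id : Module.Dual K K)
        ((m ≫ (vectDoubleDualMonad K).map (ModuleCat.ofHom p)).hom x :
          Module.Dual K (Module.Dual K K))).symm

end VectorSpaces

end CodensityPresentation

theorem theorem4p5 :
    -- sets: the forgetful functor from finite Boolean algebras
    CodensityPresentation.IsCodensityMonad
      CodensityPresentation.neighbourhoodMonad.{w} (forget FinBoolAlg.{w}) ∧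
    -- meet-semilattices with top: the inclusion of the finite ones
    CodensityPresentation.IsCodensityMonad
      CodensityPresentation.mslDoubleDualMonad.{w} CodensityPresentation.finiteMSL.{w}.ι ∧
    -- vector spaces over a field: the inclusion of the finite-dimensional ones
    ∀ (K : Type w) [Field K],
      CodensityPresentation.IsCodensityMonad
        (CodensityPresentation.vectDoubleDualMonad K) (ModuleCat.isFG.{w} K).ι := by
  exact ⟨CodensityPresentation.isCodensityMonad_neighbourhoodMonad,
    CodensityPresentation.isCodensityMonad_mslDoubleDualMonad,
    fun K _ => CodensityPresentation.isCodensityMonad_vectDoubleDualMonad K⟩
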